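/- There exist universal constants $c_1, c_2 > 0$ (independent of $n$, $K$ and $\delta$) such that the following holds. Let $K \subset \mathbb{R}^n$ be a convex body (a compact convex set with non-empty interior) which is symmetric ($x \in K$ implies $-x \in K$) and has volume $|K| = 1$. For $\delta \in (0, \tfrac12)$ let $$K_\delta = \bigcap_{\theta \in S^{n-1}} \{x \in K : |\langle x, \theta\rangle| \le t_\theta\}, \qquad t_\theta = \sup\{t > 0 : |\{x \in K : |\langle x, \theta\rangle| \le t\}| = 1-\delta\},$$ be the floating body of $K$, and let $$\Lambda_K^*(x) = \sup_{u \in \mathbb{R}^n} \Big\{ \langle x, u\rangle - \log \int_K e^{\langle y, u\rangle}\, dy \Big\} \in [0, \infty], \qquad x \in \mathbb{R}^n,$$ be the Legendre transform of the logarithmic Laplace transform of $K$. Then for every $\delta \in (0, \tfrac12)$, $$c_1 \Big\{x \in \mathbb{R}^n : \Lambda_K^*(x) \le \log\tfrac1\delta\Big\} \subseteq K_\delta \subseteq c_2 \Big\{x \in \mathbb{R}^n : \Lambda_K^*(x) \le \log\tfrac1\delta\Big\}.$$ -/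

import Mathlib

open MeasureTheory
open scoped Pointwise

/-- The number `t_θ = sup {t > 0 : |{x ∈ K : |⟨x, θ⟩| ≤ t}| = 1 - δ}`: the half-width of the
symmetric slab orthogonal to `θ` outside which `K` (of volume one) has volume `δ`. -/
noncomputable def floatingWidth {n : ℕ} (K : Set (EuclideanSpace ℝ (Fin n))) (δ : ℝ)
    (θ : EuclideanSpace ℝ (Fin n)) : ℝ :=
  sSup {t : ℝ | 0 < t ∧ volume {x | x ∈ K ∧ |inner ℝ x θ| ≤ t} = ENNReal.ofReal (1 - δ)}

/-- The floating body `K_δ` of a symmetric convex body `K` of volume one: the intersection over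
the unit sphere of the sets `{x ∈ K : |⟨x, θ⟩| ≤ t_θ}`. -/
noncomputable def floatingBody {n : ℕ} (K : Set (EuclideanSpace ℝ (Fin n))) (δ : ℝ) :
    Set (EuclideanSpace ℝ (Fin n)) :=
  ⋂ θ ∈ Metric.sphere (0 : EuclideanSpace ℝ (Fin n)) 1,
    {x | x ∈ K ∧ |inner ℝ x θ| ≤ floatingWidth K δ θ}

/-- The logarithmic Laplace transform `Λ_K(u) = log ∫_K exp ⟨y, u⟩ dy`. -/
noncomputable def logLaplace {n : ℕ} (K : Set (EuclideanSpace ℝ (Fin n)))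
    (u : EuclideanSpace ℝ (Fin n)) : ℝ :=
  Real.log (∫ y in K, Real.exp (inner ℝ y u))

/-- The Legendre transform `Λ_K^*(x) = sup_u (⟨x, u⟩ - Λ_K(u))`, a supremum in `[-∞, ∞]`. -/
noncomputable def logLaplaceLegendre {n : ℕ} (K : Set (EuclideanSpace ℝ (Fin n)))
    (x : EuclideanSpace ℝ (Fin n)) : EReal :=
  ⨆ u : EuclideanSpace ℝ (Fin n), ((inner ℝ x u - logLaplace K u : ℝ) : EReal)

/-- The level set `B_r(K) = {x : Λ_K^*(x) ≤ r}`. -/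
noncomputable def legendreLevelSet {n : ℕ} (K : Set (EuclideanSpace ℝ (Fin n))) (r : ℝ) :
    Set (EuclideanSpace ℝ (Fin n)) :=
  {x | logLaplaceLegendre K x ≤ (r : EReal)}

/-!
By the Prékopa–Leindler inequality the volume of the cap `{x ∈ K | s < ⟨x, θ⟩}` is log-concave
in `s`. It is `1 / 2` at `s = 0` and `δ / 2` at `s = t_θ`, hence at most `δ ^ (s / t_θ) / 2` for
`s ≥ t_θ`. Integrating this tail bounds `Λ_K(u)` by `log 2 + log (1 / δ) / 2` at
`u = (log (1 / δ) / (2 t_θ)) θ`, so that `Λ_K^*(x) ≤ log (1 / δ)` forces `⟨x, θ⟩ ≤ 5 t_θ`.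

Conversely, the cap at height `t_θ` alone gives `Λ_K(s θ) ≥ s t_θ + log (δ / 2)` for `s ≥ 0`.
Since `Λ_K ≥ 0` by symmetry, this yields `Λ_K^*(x / 2) ≤ log (1 / δ)` for every `x` in the floating
body.
-/

section PrekopaLeindler

open ENNReal

theorem volume_add_volume_le_volume_add_of_isCompact {A B : Set ℝ} (hA : IsCompact A)
    (hB : IsCompact B) (hA₀ : A.Nonempty) (hB₀ : B.Nonempty) :
    volume A + volume B ≤ volume (A + B) := by
  obtain ⟨a, haA, ha⟩ := hA.exists_isGreatest hA₀
  obtain ⟨b, hbB, hb⟩ := hB.exists_isLeast hB₀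
  -- `b + A` lies to the left of `a + B`, and the two translates only share the point `a + b`.
  have hdisj : AEDisjoint volume (b +ᵥ A) (a +ᵥ B) := by
    refine measure_mono_null (t := {a + b}) ?_ (measure_singleton _)
    rintro _ ⟨⟨x, hx, rfl⟩, y, hy, hxy⟩
    have hxa := ha hx
    have hby := hb hy
    simp only [vadd_eq_add, Set.mem_singleton_iff] at hxy ⊢
    linarith
  calc volume A + volume B = volume (b +ᵥ A) + volume (a +ᵥ B) := by
        rw [measure_vadd, measure_vadd]
    _ = volume ((b +ᵥ A) ∪ (a +ᵥ B)) :=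
        (measure_union₀ (hB.measurableSet.const_vadd a).nullMeasurableSet hdisj).symm
    _ ≤ volume (A + B) := by
        gcongr
        rintro _ (⟨x, hx, rfl⟩ | ⟨y, hy, rfl⟩)
        · exact ⟨x, hx, b, hbB, add_comm x b⟩
        · exact ⟨a, haA, y, hy, rfl⟩

theorem volume_add_volume_le_volume_add {A B : Set ℝ} (hA : MeasurableSet A)
    (hB : MeasurableSet B) (hA₀ : A.Nonempty) (hB₀ : B.Nonempty) :
    volume A + volume B ≤ volume (A + B) := by
  obtain ⟨a, ha⟩ := hA₀
  obtain ⟨b, hb⟩ := hB₀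
  rw [hA.measure_eq_iSup_isCompact, hB.measure_eq_iSup_isCompact]
  simp_rw [iSup_and']
  refine biSup_add_biSup_le' ⟨∅, by simp⟩ ⟨∅, by simp⟩ ?_
  rintro A' ⟨hA', hA'c⟩ B' ⟨hB', hB'c⟩
  calc volume A' + volume B' ≤ volume (insert a A') + volume (insert b B') := by
        gcongr <;> exact Set.subset_insert _ _
    _ ≤ volume (insert a A' + insert b B') :=
        volume_add_volume_le_volume_add_of_isCompact (hA'c.insert a) (hB'c.insert b)
          (Set.insert_nonempty _ _) (Set.insert_nonempty _ _)
    _ ≤ volume (A + B) := by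
        gcongr
        exacts [Set.insert_subset ha hA', Set.insert_subset hb hB']

theorem volume_setOf_pos_and_ofReal_lt (c : ℝ≥0∞) :
    volume {t : ℝ | 0 < t ∧ ENNReal.ofReal t < c} = c := by
  rcases eq_or_ne c ∞ with rfl | hc
  · simp only [ofReal_lt_top, and_true]
    exact Real.volume_Ioi
  · have hIoo : {t : ℝ | 0 < t ∧ ENNReal.ofReal t < c} = Set.Ioo 0 c.toReal := by
      ext t
      exact and_congr_right fun ht => ofReal_lt_iff_lt_toReal ht.le hc
    rw [hIoo, Real.volume_Ioo, sub_zero, ofReal_toReal hc]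

theorem lintegral_eq_lintegral_measure_ofReal_lt {α : Type*} [MeasurableSpace α] (μ : Measure α)
    [SFinite μ] {f : α → ℝ≥0∞} (hf : Measurable f) :
    ∫⁻ x, f x ∂μ = ∫⁻ t in Set.Ioi (0 : ℝ), μ {x | ENNReal.ofReal t < f x} := by
  -- Both sides are the measure of the region under the graph of `f`.
  have hS : MeasurableSet {p : α × ℝ | 0 < p.2 ∧ ENNReal.ofReal p.2 < f p.1} :=
    (measurableSet_lt measurable_const measurable_snd).inter
      (measurableSet_lt (measurable_ofReal.comp measurable_snd) (hf.comp measurable_fst))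
  have hfubini := (Measure.prod_apply (μ := μ) (ν := volume) hS).symm.trans
    (Measure.prod_apply_symm hS)
  simp only [Set.preimage_ofPred_eq, volume_setOf_pos_and_ofReal_lt] at hfubini
  rw [hfubini, ← lintegral_indicator measurableSet_Ioi]
  refine lintegral_congr fun t => ?_
  by_cases ht : 0 < t <;> simp [ht]

theorem iSup_lintegral_min_natCast {α : Type*} [MeasurableSpace α] (μ : Measure α)
    {f : α → ℝ≥0∞} (hf : Measurable f) :
    ⨆ n : ℕ, ∫⁻ x, min (f x) n ∂μ = ∫⁻ x, f x ∂μ := by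
  have hmono : Monotone fun (n : ℕ) x => min (f x) n :=
    fun m n hmn x => min_le_min_left _ (Nat.cast_le.2 hmn)
  rw [← lintegral_iSup (fun n => hf.min measurable_const) hmono]
  refine lintegral_congr fun x => ?_
  rw [← inf_iSup_eq, iSup_natCast, inf_top_eq]

variable {a b : ℝ}

theorem rpow_mul_rpow_le_ofReal_mul_add_ofReal_mul (ha : 0 < a) (hb : 0 < b) (hab : a + b = 1)
    (x y : ℝ≥0∞) : x ^ a * y ^ b ≤ ENNReal.ofReal a * x + ENNReal.ofReal b * y := by
  rcases eq_or_ne x ∞ with rfl | hx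
  · simp [mul_top, ha]
  rcases eq_or_ne y ∞ with rfl | hy
  · simp [mul_top, hb]
  lift x to NNReal using hx
  lift y to NNReal using hy
  have hab' : a.toNNReal + b.toNNReal = 1 := by
    rw [← Real.toNNReal_add ha.le hb.le, hab, Real.toNNReal_one]
  have hamgm := NNReal.geom_mean_le_arith_mean2_weighted a.toNNReal b.toNNReal x y hab'
  rw [Real.coe_toNNReal a ha.le, Real.coe_toNNReal b hb.le] at hamgm
  rw [← coe_rpow_of_nonneg _ ha.le, ← coe_rpow_of_nonneg _ hb.le]
  exact coe_le_coe.2 hamgm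

theorem rpow_mul_rpow_self (ha : 0 ≤ a) (hb : 0 ≤ b) (hab : a + b = 1) (x : ℝ≥0∞) :
    x ^ a * x ^ b = x := by
  rw [← rpow_add_of_nonneg a b ha hb, hab, rpow_one]

theorem ofReal_mul_volume_add_le_volume_smul_add_smul (ha : 0 ≤ a) (hb : 0 ≤ b) {A B : Set ℝ}
    (hA : MeasurableSet A) (hB : MeasurableSet B) (hA₀ : A.Nonempty) (hB₀ : B.Nonempty) :
    ENNReal.ofReal a * volume A + ENNReal.ofReal b * volume B ≤ volume (a • A + b • B) := by
  have hvol_smul : ∀ {c : ℝ}, 0 ≤ c → ∀ S : Set ℝ, volume (c • S) = ENNReal.ofReal c * volume S :=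
    fun hc S => by simp [Measure.addHaar_smul, abs_of_nonneg hc]
  rw [← hvol_smul ha, ← hvol_smul hb]
  exact volume_add_volume_le_volume_add (hA.const_smul₀ a) (hB.const_smul₀ b)
    hA₀.smul_set hB₀.smul_set

theorem ofReal_mul_lintegral_add_le_of_iSup_eq_one (ha : 0 < a) (hb : 0 < b) (hab : a + b = 1)
    {f g h : ℝ → ℝ≥0∞} (hf : Measurable f) (hg : Measurable g) (hh : Measurable h)
    (hf₁ : ⨆ x, f x = 1) (hg₁ : ⨆ x, g x = 1)
    (hfgh : ∀ x y, f x ^ a * g y ^ b ≤ h (a • x + b • y)) :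
    ENNReal.ofReal a * (∫⁻ x, f x) + ENNReal.ofReal b * (∫⁻ x, g x) ≤ ∫⁻ x, h x := by
  have hlevel : ∀ t : ℝ, ENNReal.ofReal a * volume {x | ENNReal.ofReal t < f x} +
      ENNReal.ofReal b * volume {x | ENNReal.ofReal t < g x} ≤
        volume {x | ENNReal.ofReal t < h x} := by
    intro t
    rcases lt_or_ge (ENNReal.ofReal t) 1 with ht | ht
    · refine (ofReal_mul_volume_add_le_volume_smul_add_smul ha.le hb.le
        (measurableSet_lt (by fun_prop) hf) (measurableSet_lt (by fun_prop) hg)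
        (lt_iSup_iff.1 (ht.trans_eq hf₁.symm)) (lt_iSup_iff.1 (ht.trans_eq hg₁.symm))).trans
        (measure_mono ?_)
      rintro _ ⟨_, ⟨x, hx, rfl⟩, _, ⟨y, hy, rfl⟩, rfl⟩
      calc ENNReal.ofReal t = ENNReal.ofReal t ^ a * ENNReal.ofReal t ^ b :=
            (rpow_mul_rpow_self ha.le hb.le hab _).symm
        _ < f x ^ a * g y ^ b := ENNReal.mul_lt_mul (rpow_lt_rpow hx ha) (rpow_lt_rpow hy hb)
        _ ≤ h (a • x + b • y) := hfgh x y
    · have hf_empty : {x | ENNReal.ofReal t < f x} = ∅ :=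
        Set.eq_empty_of_forall_notMem fun x => (((le_iSup f x).trans_eq hf₁).trans ht).not_gt
      have hg_empty : {x | ENNReal.ofReal t < g x} = ∅ :=
        Set.eq_empty_of_forall_notMem fun x => (((le_iSup g x).trans_eq hg₁).trans ht).not_gt
      simp [hf_empty, hg_empty]
  have hlevel_meas : AEMeasurable (fun t : ℝ => ENNReal.ofReal a *
      volume {x | ENNReal.ofReal t < f x}) (volume.restrict (Set.Ioi 0)) := by
    refine Measurable.aemeasurable (Measurable.const_mul (Antitone.measurable fun s t hst =>
      measure_mono fun x hx => ?_) _)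
    exact (ofReal_le_ofReal hst).trans_lt hx
  rw [lintegral_eq_lintegral_measure_ofReal_lt _ hf, lintegral_eq_lintegral_measure_ofReal_lt _ hg,
    lintegral_eq_lintegral_measure_ofReal_lt _ hh, ← lintegral_const_mul' _ _ ofReal_ne_top,
    ← lintegral_const_mul' _ _ ofReal_ne_top, ← lintegral_add_left' hlevel_meas]
  exact lintegral_mono hlevel

theorem lintegral_rpow_mul_lintegral_rpow_le_of_iSup_ne_top (ha : 0 < a) (hb : 0 < b)
    (hab : a + b = 1) {f g h : ℝ → ℝ≥0∞} (hf : Measurable f) (hg : Measurable g)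
    (hh : Measurable h) (hf_top : ⨆ x, f x ≠ ∞) (hg_top : ⨆ x, g x ≠ ∞)
    (hfgh : ∀ x y, f x ^ a * g y ^ b ≤ h (a • x + b • y)) :
    (∫⁻ x, f x) ^ a * (∫⁻ x, g x) ^ b ≤ ∫⁻ x, h x := by
  set F := ⨆ x, f x with hF
  set G := ⨆ x, g x with hG
  rcases eq_or_ne F 0 with hF₀ | hF₀
  · simp [iSup_eq_zero.1 (hF.symm.trans hF₀), ha]
  rcases eq_or_ne G 0 with hG₀ | hG₀
  · simp [iSup_eq_zero.1 (hG.symm.trans hG₀), hb]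
  set c := (F⁻¹) ^ a * (G⁻¹) ^ b
  have hc₀ : c ≠ 0 := by simp [c, hf_top, hg_top, hF₀, hG₀, rpow_eq_zero_iff]
  have hc_top : c ≠ ∞ := mul_ne_top (rpow_ne_top_of_nonneg ha.le (inv_ne_top.2 hF₀))
    (rpow_ne_top_of_nonneg hb.le (inv_ne_top.2 hG₀))
  have hscale : ∀ x y : ℝ≥0∞, (F⁻¹ * x) ^ a * (G⁻¹ * y) ^ b = c * (x ^ a * y ^ b) := fun x y => by
    rw [mul_rpow_of_nonneg _ _ ha.le, mul_rpow_of_nonneg _ _ hb.le, mul_mul_mul_comm]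
  have hnormalized := ofReal_mul_lintegral_add_le_of_iSup_eq_one ha hb hab
    (hf.const_mul F⁻¹) (hg.const_mul G⁻¹) (hh.const_mul c)
    (by rw [← mul_iSup, ENNReal.inv_mul_cancel hF₀ hf_top])
    (by rw [← mul_iSup, ENNReal.inv_mul_cancel hG₀ hg_top])
    fun x y => by rw [hscale]; gcongr; exact hfgh x y
  rw [lintegral_const_mul _ hf, lintegral_const_mul _ hg, lintegral_const_mul _ hh] at hnormalized
  refine (ENNReal.mul_le_mul_iff_right hc₀ hc_top).1 ?_
  rw [← hscale]
  exact (rpow_mul_rpow_le_ofReal_mul_add_ofReal_mul ha hb hab _ _).trans hnormalized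

/-- The Prékopa–Leindler inequality for the measure `μ`, for `[0, ∞]`-valued functions. -/
def SatisfiesPrekopaLeindler {E : Type*} [AddCommGroup E] [Module ℝ E] [MeasurableSpace E]
    (μ : Measure E) : Prop :=
  ∀ ⦃a b : ℝ⦄, 0 < a → 0 < b → a + b = 1 → ∀ ⦃f g h : E → ℝ≥0∞⦄,
    Measurable f → Measurable g → Measurable h →
      (∀ x y, f x ^ a * g y ^ b ≤ h (a • x + b • y)) →
        (∫⁻ x, f x ∂μ) ^ a * (∫⁻ x, g x ∂μ) ^ b ≤ ∫⁻ x, h x ∂μ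

theorem satisfiesPrekopaLeindler_volume_real :
    SatisfiesPrekopaLeindler (volume : Measure ℝ) := by
  intro a b ha hb hab f g h hf hg hh hfgh
  have hrpow_iSup : ∀ {c : ℝ}, 0 < c → ∀ u : ℕ → ℝ≥0∞, (⨆ n, u n) ^ c = ⨆ n, u n ^ c :=
    fun hc u => (orderIsoRpow _ hc).map_iSup u
  rw [← iSup_lintegral_min_natCast _ hf, ← iSup_lintegral_min_natCast _ hg, hrpow_iSup ha,
    hrpow_iSup hb, iSup_mul]
  refine iSup_le fun m => ?_
  rw [mul_iSup]
  refine iSup_le fun n => lintegral_rpow_mul_lintegral_rpow_le_of_iSup_ne_top ha hb hab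
    (by fun_prop) (by fun_prop) hh
    (ne_top_of_le_ne_top (natCast_ne_top m) (iSup_le fun x => min_le_right _ _))
    (ne_top_of_le_ne_top (natCast_ne_top n) (iSup_le fun x => min_le_right _ _))
    fun x y => le_trans ?_ (hfgh x y)
  gcongr <;> exact min_le_left _ _

namespace SatisfiesPrekopaLeindler

variable {E F : Type*} [AddCommGroup E] [Module ℝ E] [MeasurableSpace E]
  [AddCommGroup F] [Module ℝ F] [MeasurableSpace F] {μ : Measure E} {ν : Measure F}

theorem prod [SFinite ν] (hμ : SatisfiesPrekopaLeindler μ) (hν : SatisfiesPrekopaLeindler ν) :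
    SatisfiesPrekopaLeindler (μ.prod ν) := by
  intro a b ha hb hab f g h hf hg hh hfgh
  rw [lintegral_prod _ hf.aemeasurable, lintegral_prod _ hg.aemeasurable,
    lintegral_prod _ hh.aemeasurable]
  exact hμ ha hb hab hf.lintegral_prod_right' hg.lintegral_prod_right' hh.lintegral_prod_right'
    fun x y => hν ha hb hab (by fun_prop) (by fun_prop) (by fun_prop)
      fun u v => hfgh (x, u) (y, v)

theorem map (hν : SatisfiesPrekopaLeindler ν) (φ : F →ₗ[ℝ] E) (hφ : Measurable φ) :
    SatisfiesPrekopaLeindler (ν.map φ) := by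
  intro a b ha hb hab f g h hf hg hh hfgh
  rw [lintegral_map hf hφ, lintegral_map hg hφ, lintegral_map hh hφ]
  refine hν ha hb hab (by fun_prop) (by fun_prop) (by fun_prop) fun x y => ?_
  simpa only [map_add, map_smul] using hfgh (φ x) (φ y)

theorem smul (hμ : SatisfiesPrekopaLeindler μ) (c : ℝ≥0∞) :
    SatisfiesPrekopaLeindler (c • μ) := by
  intro a b ha hb hab f g h hf hg hh hfgh
  simp only [lintegral_smul_measure, smul_eq_mul]
  rw [mul_rpow_of_nonneg _ _ ha.le, mul_rpow_of_nonneg _ _ hb.le, mul_mul_mul_comm,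
    rpow_mul_rpow_self ha.le hb.le hab]
  gcongr
  exact hμ ha hb hab hf hg hh hfgh

theorem measure_rpow_mul_measure_rpow_le (hμ : SatisfiesPrekopaLeindler μ) (ha : 0 < a)
    (hb : 0 < b) (hab : a + b = 1) {A B : Set E} (hA : MeasurableSet A) (hB : MeasurableSet B) :
    μ A ^ a * μ B ^ b ≤ μ (a • A + b • B) := by
  have hC := measurableSet_toMeasurable μ (a • A + b • B)
  have hindicator := hμ ha hb hab (measurable_one.indicator hA) (measurable_one.indicator hB)
    (measurable_one.indicator hC) fun x y => ?_
  · simpa only [lintegral_indicator_one hA, lintegral_indicator_one hB,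
      lintegral_indicator_one hC, measure_toMeasurable] using hindicator
  · by_cases hx : x ∈ A
    · by_cases hy : y ∈ B
      · have hxy : a • x + b • y ∈ toMeasurable μ (a • A + b • B) :=
          subset_toMeasurable _ _
            (Set.add_mem_add (Set.smul_mem_smul_set hx) (Set.smul_mem_smul_set hy))
        simp [hx, hy, hxy]
      · simp [hy, hb]
    · simp [hx, ha]

end SatisfiesPrekopaLeindler

theorem satisfiesPrekopaLeindler_volume_pi (n : ℕ) :
    SatisfiesPrekopaLeindler (volume : Measure (Fin n → ℝ)) := by
  induction n with
  | zero =>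
    intro a b _ _ _ f g h _ _ _ hfgh
    simp only [lintegral_unique, volume_pi, Measure.pi_empty_univ, mul_one]
    convert hfgh default default
  | succ n ih =>
    have hcons : MeasurePreserving (Fin.consEquivL ℝ fun _ : Fin (n + 1) => ℝ) := by
      convert (volume_preserving_piFinSuccAbove (fun _ : Fin (n + 1) => ℝ) 0).symm using 1
      ext x i
      simp [MeasurableEquiv.piFinSuccAbove]
    rw [← hcons.map_eq]
    exact (satisfiesPrekopaLeindler_volume_real.prod ih).map
      (Fin.consLinearEquiv ℝ fun _ => ℝ).toLinearMap hcons.measurable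

theorem satisfiesPrekopaLeindler_of_isAddHaarMeasure {E : Type*} [NormedAddCommGroup E]
    [NormedSpace ℝ E] [FiniteDimensional ℝ E] [MeasurableSpace E] [BorelSpace E] (μ : Measure E)
    [μ.IsAddHaarMeasure] : SatisfiesPrekopaLeindler μ := by
  let e := (Module.finBasis ℝ E).equivFunL.symm
  rw [Measure.isAddLeftInvariant_eq_smul μ (volume.map e)]
  exact ((satisfiesPrekopaLeindler_volume_pi _).map e.toLinearEquiv.toLinearMap
    e.continuous.measurable).smul (Measure.addHaarScalarFactor μ (volume.map e))

end PrekopaLeindler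

section Caps

open ENNReal

variable {E : Type*} [NormedAddCommGroup E] [InnerProductSpace ℝ E] {K : Set E} {θ : E} {s t : ℝ}

/-- The cap cut off from `K` by the half-space of points at height more than `t` in the direction
`θ`. The inequality is strict, so that for `0 ≤ t` a symmetric set is the disjoint union of a slab
and two opposite caps. -/
def halfSpaceCap (K : Set E) (θ : E) (t : ℝ) : Set E :=
  {x | x ∈ K ∧ t < inner ℝ x θ}

/-- The slab of half-width `t` around the hyperplane orthogonal to `θ`, intersected with `K`: the
set whose volume enters the definition of `floatingWidth`. -/
def symmetricSlab (K : Set E) (θ : E) (t : ℝ) : Set E :=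
  {x | x ∈ K ∧ |inner ℝ x θ| ≤ t}

theorem halfSpaceCap_subset : halfSpaceCap K θ t ⊆ K :=
  fun _ hx => hx.1

theorem antitone_halfSpaceCap : Antitone (halfSpaceCap K θ) :=
  fun _ _ hst _ hx => ⟨hx.1, hst.trans_lt hx.2⟩

theorem exists_forall_symmetricSlab_eq_self (hK : IsCompact K) (θ : E) :
    ∃ R : ℝ, 0 ≤ R ∧ ∀ t, R ≤ t → symmetricSlab K θ t = K := by
  obtain ⟨R, hR⟩ := hK.exists_bound_of_continuousOn (f := fun x : E => inner ℝ x θ) (by fun_prop)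
  exact ⟨max R 0, le_max_right _ _, fun t ht => Set.Subset.antisymm (fun x hx => hx.1)
    fun x hx => ⟨hx, (hR x hx).trans ((le_max_left _ _).trans ht)⟩⟩

theorem smul_halfSpaceCap_add_smul_halfSpaceCap_subset (hK : Convex ℝ K) {a b : ℝ} (ha : 0 < a)
    (hb : 0 < b) (hab : a + b = 1) :
    a • halfSpaceCap K θ s + b • halfSpaceCap K θ t ⊆ halfSpaceCap K θ (a * s + b * t) := by
  rintro _ ⟨_, ⟨x, ⟨hxK, hx⟩, rfl⟩, _, ⟨y, ⟨hyK, hy⟩, rfl⟩, rfl⟩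
  refine ⟨hK hxK hyK ha.le hb.le hab, ?_⟩
  simp only [inner_add_left, real_inner_smul_left]
  gcongr

variable [MeasurableSpace E] [BorelSpace E] {μ : Measure E}

theorem measurableSet_halfSpaceCap (hK : MeasurableSet K) :
    MeasurableSet (halfSpaceCap K θ t) := by
  have hhalfSpace : IsOpen {x | t < inner ℝ x θ} := isOpen_lt continuous_const (by fun_prop)
  exact hK.inter hhalfSpace.measurableSet

theorem measurableSet_symmetricSlab (hK : MeasurableSet K) :
    MeasurableSet (symmetricSlab K θ t) := by
  have hslab : IsClosed {x | |inner ℝ x θ| ≤ t} := isClosed_le (by fun_prop) continuous_const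
  exact hK.inter hslab.measurableSet

theorem measure_symmetricSlab_add_two_mul_measure_halfSpaceCap [μ.IsNegInvariant]
    (hK : MeasurableSet K) (hsymm : ∀ x ∈ K, -x ∈ K) (ht : 0 ≤ t) :
    μ (symmetricSlab K θ t) + 2 * μ (halfSpaceCap K θ t) = μ K := by
  have hcap := measurableSet_halfSpaceCap (θ := θ) (t := t) hK
  have hpartition : symmetricSlab K θ t ∪ (halfSpaceCap K θ t ∪ -halfSpaceCap K θ t) = K := by
    have hneg : ∀ x, -x ∈ K ↔ x ∈ K := fun x => ⟨fun hx => neg_neg x ▸ hsymm _ hx, hsymm x⟩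
    ext x
    simp only [symmetricSlab, halfSpaceCap, Set.mem_union, Set.mem_neg, Set.mem_ofPred_eq, hneg,
      inner_neg_left, ← and_or_left, ← lt_abs]
    exact and_iff_left (le_or_gt _ _)
  have hdisj : Disjoint (halfSpaceCap K θ t) (-halfSpaceCap K θ t) := by
    refine Set.disjoint_left.2 fun x hx hx' => ?_
    have hneg := hx'.2
    rw [inner_neg_left] at hneg
    linarith [hx.2]
  have hdisj_slab : Disjoint (symmetricSlab K θ t) (halfSpaceCap K θ t ∪ -halfSpaceCap K θ t) := by
    refine Set.disjoint_left.2 fun x hx hx' =>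
      hx.2.not_gt (lt_abs.2 (hx'.imp And.right fun h => ?_))
    simpa only [inner_neg_left] using h.2
  nth_rw 1 [two_mul, ← Measure.measure_neg μ (halfSpaceCap K θ t), add_comm (μ (-_))]
  rw [← measure_union hdisj hcap.neg, ← measure_union hdisj_slab (hcap.union hcap.neg), hpartition]

variable [FiniteDimensional ℝ E] [μ.IsAddHaarMeasure]

theorem measure_setOf_inner_eq (hθ : θ ≠ 0) (c : ℝ) : μ {x | inner ℝ x θ = c} = 0 := by
  rcases Set.eq_empty_or_nonempty {x : E | inner ℝ x θ = c} with hempty | ⟨x₀, hx₀⟩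
  · rw [hempty, measure_empty]
  · have hne_top : (ℝ ∙ θ)ᗮ ≠ ⊤ := fun htop => hθ <| inner_self_eq_zero (𝕜 := ℝ).1 <|
      Submodule.mem_orthogonal_singleton_iff_inner_left.1 (htop ▸ Submodule.mem_top)
    have hnull := Measure.addHaar_submodule μ _ hne_top
    rw [← measure_preimage_add_right μ (-x₀)] at hnull
    refine measure_mono_null (fun x hx => ?_) hnull
    simp only [Set.mem_ofPred_eq] at hx hx₀
    simp only [Set.mem_preimage, SetLike.mem_coe, inner_add_left, inner_neg_left, hx, hx₀,
      Submodule.mem_orthogonal_singleton_iff_inner_left, add_neg_cancel]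

theorem measure_setOf_abs_inner_eq (hθ : θ ≠ 0) (c : ℝ) : μ {x | |inner ℝ x θ| = c} = 0 := by
  refine measure_mono_null (fun x hx => ?_)
    (measure_union_null (measure_setOf_inner_eq hθ c) (measure_setOf_inner_eq hθ (-c)))
  exact eq_or_eq_neg_of_abs_eq hx

theorem measure_symmetricSlab_zero (hθ : θ ≠ 0) : μ (symmetricSlab K θ 0) = 0 :=
  measure_mono_null (fun _ hx => abs_nonpos_iff.1 hx.2) (measure_setOf_inner_eq hθ 0)

theorem continuous_measure_symmetricSlab (hK : MeasurableSet K) (hKμ : μ K ≠ ∞) (hθ : θ ≠ 0) :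
    Continuous fun t => μ (symmetricSlab K θ t) := by
  refine continuous_iff_continuousAt.2 fun t₀ => ?_
  refine tendsto_measure_of_ae_tendsto_indicator (B := K) _ (measurableSet_symmetricSlab hK)
    (fun t => measurableSet_symmetricSlab hK) hK hKμ
    (Filter.Eventually.of_forall fun t x hx => hx.1) ?_
  have hae : ∀ᵐ x ∂μ, |inner ℝ x θ| ≠ t₀ :=
    measure_eq_zero_iff_ae_notMem.1 (measure_setOf_abs_inner_eq hθ t₀)
  filter_upwards [hae] with x hx
  rcases lt_or_gt_of_ne hx with hlt | hgt
  · filter_upwards [lt_mem_nhds hlt] with t ht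
    simp [symmetricSlab, ht.le, hlt.le]
  · filter_upwards [gt_mem_nhds hgt] with t ht
    simp [symmetricSlab, ht.not_ge, hgt.not_ge]

theorem isGreatest_sSup_setOf_measure_symmetricSlab_eq (hK : IsCompact K) (hθ : θ ≠ 0) {v : ℝ≥0∞}
    (hv₀ : 0 < v) (hv : v < μ K) :
    IsGreatest {t : ℝ | 0 < t ∧ μ (symmetricSlab K θ t) = v}
      (sSup {t : ℝ | 0 < t ∧ μ (symmetricSlab K θ t) = v}) := by
  set S := {t : ℝ | 0 < t ∧ μ (symmetricSlab K θ t) = v}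
  have hcont : Continuous fun t => μ (symmetricSlab K θ t) :=
    continuous_measure_symmetricSlab hK.measurableSet hK.measure_lt_top.ne hθ
  obtain ⟨R, hR, hRK⟩ := exists_forall_symmetricSlab_eq_self hK θ
  have hS_nonneg : S = Set.Ici 0 ∩ {t | μ (symmetricSlab K θ t) = v} := by
    refine Set.ext fun t => and_congr_left fun ht => ⟨le_of_lt, fun ht₀ => ht₀.lt_of_ne ?_⟩
    rintro rfl
    exact hv₀.ne ((measure_symmetricSlab_zero hθ).symm.trans ht)
  have hclosed : IsClosed S :=
    hS_nonneg ▸ isClosed_Ici.inter (isClosed_eq hcont continuous_const)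
  have hbdd : BddAbove S := by
    refine ⟨R, fun t ht => le_of_not_gt fun hRt => hv.ne ?_⟩
    rw [← ht.2, hRK t hRt.le]
  have hne : S.Nonempty := by
    have hmem : v ∈ Set.Icc (μ (symmetricSlab K θ 0)) (μ (symmetricSlab K θ R)) :=
      ⟨(measure_symmetricSlab_zero hθ).trans_le hv₀.le, hv.le.trans_eq (by rw [hRK R le_rfl])⟩
    obtain ⟨t, ht, htv⟩ := intermediate_value_Icc hR hcont.continuousOn hmem
    exact ⟨t, hS_nonneg ▸ ⟨ht.1, htv⟩⟩
  exact ⟨hclosed.csSup_mem hne hbdd, fun t ht => le_csSup hbdd ht⟩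

theorem measure_halfSpaceCap_rpow_mul_rpow_le (hK : Convex ℝ K) (hKm : MeasurableSet K) {a b : ℝ}
    (ha : 0 < a) (hb : 0 < b) (hab : a + b = 1) :
    μ (halfSpaceCap K θ s) ^ a * μ (halfSpaceCap K θ t) ^ b ≤
      μ (halfSpaceCap K θ (a * s + b * t)) :=
  ((satisfiesPrekopaLeindler_of_isAddHaarMeasure μ).measure_rpow_mul_measure_rpow_le ha hb hab
    (measurableSet_halfSpaceCap hKm) (measurableSet_halfSpaceCap hKm)).trans
    (measure_mono (smul_halfSpaceCap_add_smul_halfSpaceCap_subset hK ha hb hab))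

theorem measure_halfSpaceCap_le_rpow_mul (hK : Convex ℝ K) (hKm : MeasurableSet K)
    (hKμ : μ K ≠ ∞) (ht : 0 < t) (hts : t < s) {q : ℝ≥0∞}
    (hq : μ (halfSpaceCap K θ t) ≤ q * μ (halfSpaceCap K θ 0)) :
    μ (halfSpaceCap K θ s) ≤ q ^ (s / t) * μ (halfSpaceCap K θ 0) := by
  have hs : 0 < s := ht.trans hts
  set P := μ (halfSpaceCap K θ 0)
  have hP_top : P ≠ ∞ := measure_ne_top_of_subset halfSpaceCap_subset hKμ
  rcases eq_or_ne P 0 with hP₀ | hP₀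
  · exact (measure_mono (antitone_halfSpaceCap hs.le)).trans (hP₀.le.trans zero_le)
  have hb : 0 < t / s := div_pos ht hs
  have ha : 0 < 1 - t / s := sub_pos.2 ((div_lt_one hs).2 hts)
  have hPa : P ^ (1 - t / s) ≠ ∞ := rpow_ne_top_of_nonneg ha.le hP_top
  have hconcave : P ^ (1 - t / s) * μ (halfSpaceCap K θ s) ^ (t / s) ≤
      P ^ (1 - t / s) * (q * P ^ (t / s)) :=
    calc P ^ (1 - t / s) * μ (halfSpaceCap K θ s) ^ (t / s)
        ≤ μ (halfSpaceCap K θ ((1 - t / s) * 0 + t / s * s)) :=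
          measure_halfSpaceCap_rpow_mul_rpow_le hK hKm ha hb (sub_add_cancel _ _)
      _ ≤ q * P := by rwa [mul_zero, zero_add, div_mul_cancel₀ _ hs.ne']
      _ = P ^ (1 - t / s) * (q * P ^ (t / s)) := by
          rw [mul_left_comm, rpow_mul_rpow_self ha.le hb.le (sub_add_cancel _ _)]
  have hroot := (ENNReal.mul_le_mul_iff_right (rpow_pos (pos_iff_ne_zero.2 hP₀) hP_top).ne'
    hPa).1 hconcave
  rw [← le_rpow_inv_iff hb, mul_rpow_of_nonneg _ _ (inv_nonneg.2 hb.le), ← rpow_mul,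
    mul_inv_cancel₀ hb.ne', rpow_one, inv_div] at hroot
  exact hroot

end Caps

section ExponentialMoments

open ENNReal

variable {α : Type*} [MeasurableSpace α] {g : α → ℝ} {c d : ℝ}

theorem lintegral_ofReal_exp_mul_max_zero (ν : Measure α) (hg : Measurable g) (hc : 0 < c) :
    ∫⁻ x, ENNReal.ofReal (Real.exp (c * max (g x) 0)) ∂ν =
      ν Set.univ + ∫⁻ s in Set.Ioi 0, ν {x | s < g x} * ENNReal.ofReal (c * Real.exp (c * s)) := by
  have hexp : ∀ x, ENNReal.ofReal (Real.exp (c * max (g x) 0)) =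
      1 + ENNReal.ofReal (∫ s in (0 : ℝ)..max (g x) 0, c * Real.exp (c * s)) := by
    intro x
    have hone_le : 1 ≤ Real.exp (c * max (g x) 0) := Real.one_le_exp (by positivity)
    rw [intervalIntegral.integral_const_mul, intervalIntegral.integral_comp_mul_left _ hc.ne',
      integral_exp, mul_zero, Real.exp_zero, smul_eq_mul, mul_inv_cancel_left₀ hc.ne',
      ← ofReal_one, ← ofReal_add zero_le_one (sub_nonneg.2 hone_le), add_sub_cancel]
  simp only [hexp]
  rw [lintegral_add_left measurable_const, lintegral_one,
    lintegral_comp_eq_lintegral_meas_lt_mul (f := fun x => max (g x) 0)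
      (g := fun s => c * Real.exp (c * s)) ν (ae_of_all _ fun x => le_max_right _ _)
      (hg.max measurable_const).aemeasurable
      (fun t _ => Continuous.intervalIntegrable (by fun_prop) _ _)
      (ae_of_all _ fun s => by positivity)]
  congr 1
  refine setLIntegral_congr_fun measurableSet_Ioi fun s (hs : 0 < s) => ?_
  simp only [lt_max_iff, hs.not_gt, or_false]

theorem lintegral_Ioi_ofReal_mul_exp (hc : 0 < c) (hcd : c < d) :
    ∫⁻ s in Set.Ioi (0 : ℝ), ENNReal.ofReal (c * Real.exp ((c - d) * s)) =
      ENNReal.ofReal (c / (d - c)) := by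
  have hneg : c - d < 0 := sub_neg.2 hcd
  rw [← ofReal_integral_eq_lintegral_ofReal ((integrableOn_exp_mul_Ioi hneg 0).const_mul c)
    (ae_of_all _ fun s => by positivity), integral_const_mul, integral_exp_mul_Ioi hneg,
    mul_zero, Real.exp_zero, neg_div, ← div_neg, neg_sub, mul_one_div]

theorem lintegral_ofReal_exp_mul_le {ν : Measure α} (hg : Measurable g) (hc : 0 < c) (hcd : c < d)
    {A : ℝ≥0∞}
    (htail : ∀ s, 0 < s → ν {x | s < g x} ≤ A * ENNReal.ofReal (Real.exp (-(d * s)))) :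
    ∫⁻ x, ENNReal.ofReal (Real.exp (c * g x)) ∂ν ≤
      ν Set.univ + A * ENNReal.ofReal (c / (d - c)) :=
  calc ∫⁻ x, ENNReal.ofReal (Real.exp (c * g x)) ∂ν
      ≤ ∫⁻ x, ENNReal.ofReal (Real.exp (c * max (g x) 0)) ∂ν := by
        gcongr
        exact le_max_left _ _
    _ = ν Set.univ +
          ∫⁻ s in Set.Ioi 0, ν {x | s < g x} * ENNReal.ofReal (c * Real.exp (c * s)) :=
        lintegral_ofReal_exp_mul_max_zero ν hg hc
    _ ≤ ν Set.univ +
          ∫⁻ s in Set.Ioi (0 : ℝ), A * ENNReal.ofReal (c * Real.exp ((c - d) * s)) := by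
        refine add_le_add le_rfl (setLIntegral_mono' measurableSet_Ioi fun s (hs : 0 < s) => ?_)
        rw [sub_mul, sub_eq_neg_add, Real.exp_add, mul_left_comm,
          ofReal_mul (Real.exp_nonneg _), ← mul_assoc]
        gcongr
        exact htail s hs
    _ = ν Set.univ + A * ENNReal.ofReal (c / (d - c)) := by
        rw [lintegral_const_mul _ (by fun_prop), lintegral_Ioi_ofReal_mul_exp hc hcd]

variable {E : Type*} [NormedAddCommGroup E] [InnerProductSpace ℝ E] [MeasurableSpace E]
  [BorelSpace E] {μ : Measure E} {K : Set E}

theorem integrableOn_exp_inner [IsFiniteMeasureOnCompacts μ] (hK : IsCompact K) (u : E) :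
    IntegrableOn (fun y => Real.exp (inner ℝ y u)) K μ :=
  ContinuousOn.integrableOn_compact hK (by fun_prop)

theorem setIntegral_exp_inner_pos [IsFiniteMeasureOnCompacts μ] (hK : IsCompact K)
    (hKμ : μ K ≠ 0) (u : E) : 0 < ∫ y in K, Real.exp (inner ℝ y u) ∂μ := by
  have : NeZero (μ.restrict K) := ⟨fun hzero => hKμ (Measure.restrict_eq_zero.1 hzero)⟩
  exact integral_exp_pos (integrableOn_exp_inner hK u)

theorem measureReal_le_setIntegral_exp_inner [μ.IsNegInvariant] [IsFiniteMeasureOnCompacts μ]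
    (hK : IsCompact K) (hsymm : ∀ x ∈ K, -x ∈ K) (u : E) :
    μ.real K ≤ ∫ y in K, Real.exp (inner ℝ y u) ∂μ := by
  have hpre : Neg.neg ⁻¹' K = K :=
    Set.ext fun x => ⟨fun hx => neg_neg x ▸ hsymm _ hx, hsymm x⟩
  have hneg : ∫ y in K, Real.exp (inner ℝ y (-u)) ∂μ = ∫ y in K, Real.exp (inner ℝ y u) ∂μ := by
    have hpreserve := (Measure.measurePreserving_neg μ).setIntegral_preimage_emb
      (MeasurableEquiv.neg E).measurableEmbedding (fun y => Real.exp (inner ℝ y u)) K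
    simpa only [hpre, inner_neg_left, inner_neg_right] using hpreserve
  have hcosh : ∀ y, 2 ≤ Real.exp (inner ℝ y u) + Real.exp (inner ℝ y (-u)) := by
    intro y
    rw [inner_neg_right]
    linarith [Real.add_one_le_exp (inner ℝ y u), Real.add_one_le_exp (-inner ℝ y u)]
  have hint := integral_mono (μ := μ.restrict K) (continuousOn_const.integrableOn_compact hK)
    ((integrableOn_exp_inner hK u).add (integrableOn_exp_inner hK (-u))) hcosh
  simp only [Pi.add_apply] at hint
  rw [integral_add (integrableOn_exp_inner hK u) (integrableOn_exp_inner hK (-u)), hneg,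
    setIntegral_const, smul_eq_mul] at hint
  linarith

variable [FiniteDimensional ℝ E] {θ : E} {t r : ℝ}

theorem setLIntegral_exp_inner_sub_le [μ.IsAddHaarMeasure] (hK : Convex ℝ K)
    (hKm : MeasurableSet K) (hKμ : μ K ≠ ∞) (ht : 0 < t) (hr : 0 < r)
    (hcap : μ (halfSpaceCap K θ t) ≤
      ENNReal.ofReal (Real.exp (-r)) * μ (halfSpaceCap K θ 0)) :
    ∫⁻ y in K, ENNReal.ofReal (Real.exp (r / (2 * t) * (inner ℝ y θ - t))) ∂μ ≤ 2 * μ K := by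
  have htail : ∀ s, 0 < s → μ.restrict K {y | s < inner ℝ y θ - t} ≤
      μ K * ENNReal.ofReal (Real.exp (-(r / t * s))) := by
    intro s hs
    have hset : {y | s < inner ℝ y θ - t} ∩ K = halfSpaceCap K θ (t + s) := by
      ext y
      simp only [halfSpaceCap, Set.mem_inter_iff, Set.mem_ofPred_eq, lt_sub_iff_add_lt', and_comm]
    rw [Measure.restrict_apply' hKm, hset, mul_comm]
    refine (measure_halfSpaceCap_le_rpow_mul hK hKm hKμ ht (lt_add_of_pos_right t hs) hcap).trans ?_
    rw [ofReal_rpow_of_pos (Real.exp_pos _), ← Real.exp_mul]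
    gcongr
    · rw [add_div, div_self ht.ne', mul_add, mul_one, neg_mul, div_mul_eq_mul_div, mul_div_assoc]
      linarith
    · exact halfSpaceCap_subset
  have hrate : r / (2 * t) < r / t := by gcongr; linarith
  have hmoment := lintegral_ofReal_exp_mul_le (ν := μ.restrict K)
    (g := fun y => inner ℝ y θ - t) (by fun_prop) (by positivity : 0 < r / (2 * t)) hrate htail
  have hratio : r / (2 * t) / (r / t - r / (2 * t)) = 1 := by
    field_simp
    norm_num
  rwa [hratio, ofReal_one, mul_one, Measure.restrict_apply_univ, ← two_mul] at hmoment

theorem setIntegral_exp_inner_smul_le [μ.IsAddHaarMeasure] (hK : Convex ℝ K)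
    (hKm : MeasurableSet K) (hKμ : μ K ≠ ∞) (ht : 0 < t) (hr : 0 < r)
    (hcap : μ (halfSpaceCap K θ t) ≤
      ENNReal.ofReal (Real.exp (-r)) * μ (halfSpaceCap K θ 0)) :
    ∫ y in K, Real.exp (inner ℝ y ((r / (2 * t)) • θ)) ∂μ ≤ 2 * Real.exp (r / 2) * μ.real K := by
  have hshift : ∀ y : E, Real.exp (inner ℝ y ((r / (2 * t)) • θ)) =
      Real.exp (r / 2) * Real.exp (r / (2 * t) * (inner ℝ y θ - t)) := by
    intro y
    rw [real_inner_smul_right, ← Real.exp_add]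
    congr 1
    field_simp
    ring
  simp only [hshift]
  rw [integral_const_mul, mul_comm 2 (Real.exp _), mul_assoc]
  refine mul_le_mul_of_nonneg_left ?_ (Real.exp_nonneg _)
  rw [integral_eq_lintegral_of_nonneg_ae (ae_of_all _ fun y => Real.exp_nonneg _)
    (by fun_prop), ← toReal_ofNat 2, measureReal_def, ← toReal_mul]
  exact toReal_mono (mul_ne_top ofNat_ne_top hKμ)
    (setLIntegral_exp_inner_sub_le hK hKm hKμ ht hr hcap)

end ExponentialMoments

section FloatingBody

variable {n : ℕ} {K : Set (EuclideanSpace ℝ (Fin n))} {θ x : EuclideanSpace ℝ (Fin n)} {δ r t : ℝ}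

theorem floatingWidth_neg (K : Set (EuclideanSpace ℝ (Fin n))) (δ : ℝ)
    (θ : EuclideanSpace ℝ (Fin n)) : floatingWidth K δ (-θ) = floatingWidth K δ θ := by
  simp only [floatingWidth, inner_neg_right, abs_neg]

theorem isGreatest_floatingWidth (hK : IsCompact K) (hvol : volume K = 1) (hθ : θ ≠ 0)
    (hδ : 0 < δ) (hδ₁ : δ < 1) :
    IsGreatest {t | 0 < t ∧ volume (symmetricSlab K θ t) = ENNReal.ofReal (1 - δ)}
      (floatingWidth K δ θ) :=
  isGreatest_sSup_setOf_measure_symmetricSlab_eq hK hθ (ENNReal.ofReal_pos.2 (by linarith))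
    (hvol ▸ ENNReal.ofReal_lt_one.2 (by linarith))

theorem floatingWidth_pos (hK : IsCompact K) (hvol : volume K = 1) (hθ : θ ≠ 0)
    (hδ : 0 < δ) (hδ₁ : δ < 1) : 0 < floatingWidth K δ θ :=
  (isGreatest_floatingWidth hK hvol hθ hδ hδ₁).1.1

theorem two_mul_volume_halfSpaceCap_floatingWidth (hK : IsCompact K) (hsymm : ∀ x ∈ K, -x ∈ K)
    (hvol : volume K = 1) (hθ : θ ≠ 0) (hδ : 0 < δ) (hδ₁ : δ < 1) :
    2 * volume (halfSpaceCap K θ (floatingWidth K δ θ)) = ENNReal.ofReal δ := by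
  obtain ⟨hpos, hslab⟩ := (isGreatest_floatingWidth hK hvol hθ hδ hδ₁).1
  have hpartition := measure_symmetricSlab_add_two_mul_measure_halfSpaceCap (μ := volume) (θ := θ)
    hK.measurableSet hsymm hpos.le
  have hone : ENNReal.ofReal (1 - δ) + ENNReal.ofReal δ = 1 := by
    rw [← ENNReal.ofReal_add (by linarith) hδ.le, sub_add_cancel, ENNReal.ofReal_one]
  rw [hslab, hvol, ← hone] at hpartition
  exact (ENNReal.add_right_inj ENNReal.ofReal_ne_top).1 hpartition

theorem volume_halfSpaceCap_floatingWidth_eq_mul (hK : IsCompact K) (hsymm : ∀ x ∈ K, -x ∈ K)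
    (hvol : volume K = 1) (hθ : θ ≠ 0) (hδ : 0 < δ) (hδ₁ : δ < 1) :
    volume (halfSpaceCap K θ (floatingWidth K δ θ)) =
      ENNReal.ofReal δ * volume (halfSpaceCap K θ 0) := by
  have hhalf : 2 * volume (halfSpaceCap K θ 0) = 1 := by
    rw [← hvol, ← measure_symmetricSlab_add_two_mul_measure_halfSpaceCap hK.measurableSet hsymm
      le_rfl, measure_symmetricSlab_zero hθ, zero_add]
  refine (ENNReal.mul_right_inj two_ne_zero ENNReal.ofNat_ne_top).1 ?_
  rw [two_mul_volume_halfSpaceCap_floatingWidth hK hsymm hvol hθ hδ hδ₁, mul_left_comm, hhalf,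
    mul_one]

theorem logLaplace_nonneg (hK : IsCompact K) (hsymm : ∀ x ∈ K, -x ∈ K) (hvol : volume K = 1)
    (u : EuclideanSpace ℝ (Fin n)) : 0 ≤ logLaplace K u := by
  refine Real.log_nonneg ?_
  simpa only [measureReal_def, hvol, ENNReal.toReal_one] using
    measureReal_le_setIntegral_exp_inner (μ := volume) hK hsymm u

theorem logLaplace_le_of_forall_inner_le (hK : IsCompact K) (hvol : volume K = 1)
    {u : EuclideanSpace ℝ (Fin n)} {a : ℝ} (ha : ∀ y ∈ K, inner ℝ y u ≤ a) :
    logLaplace K u ≤ a := by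
  refine (Real.log_le_iff_le_exp (setIntegral_exp_inner_pos hK (hvol.trans_ne one_ne_zero) u)).2 ?_
  calc ∫ y in K, Real.exp (inner ℝ y u) ≤ ∫ _ in K, Real.exp a :=
        setIntegral_mono_on (integrableOn_exp_inner hK u)
          (continuousOn_const.integrableOn_compact hK) hK.measurableSet
          fun y hy => Real.exp_le_exp.2 (ha y hy)
    _ = Real.exp a := by
        rw [setIntegral_const, measureReal_def, hvol, ENNReal.toReal_one, one_smul]

theorem logLaplace_smul_le_of_volume_halfSpaceCap_le (hK : IsCompact K) (hconv : Convex ℝ K)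
    (hvol : volume K = 1) (ht : 0 < t) (hr : 0 < r)
    (hcap : volume (halfSpaceCap K θ t) ≤
      ENNReal.ofReal (Real.exp (-r)) * volume (halfSpaceCap K θ 0)) :
    logLaplace K ((r / (2 * t)) • θ) ≤ Real.log 2 + r / 2 := by
  refine (Real.log_le_iff_le_exp (setIntegral_exp_inner_pos hK (hvol.trans_ne one_ne_zero) _)).2 ?_
  rw [Real.exp_add, Real.exp_log two_pos]
  simpa only [measureReal_def, hvol, ENNReal.toReal_one, mul_one] using
    setIntegral_exp_inner_smul_le hconv hK.measurableSet hK.measure_lt_top.ne ht hr hcap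

theorem mul_floatingWidth_add_log_le_logLaplace (hK : IsCompact K) (hsymm : ∀ x ∈ K, -x ∈ K)
    (hvol : volume K = 1) (hθ : θ ≠ 0) (hδ : 0 < δ) (hδ₁ : δ < 1) {s : ℝ} (hs : 0 ≤ s) :
    s * floatingWidth K δ θ + Real.log (δ / 2) ≤ logLaplace K (s • θ) := by
  have hcap : volume.real (halfSpaceCap K θ (floatingWidth K δ θ)) = δ / 2 := by
    have htoReal := congrArg ENNReal.toReal
      (two_mul_volume_halfSpaceCap_floatingWidth hK hsymm hvol hθ hδ hδ₁)
    rw [ENNReal.toReal_mul, ENNReal.toReal_ofReal hδ.le, ENNReal.toReal_ofNat] at htoReal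
    rw [measureReal_def]
    linarith
  have hint := integrableOn_exp_inner (μ := volume) hK (s • θ)
  refine (Real.le_log_iff_exp_le (setIntegral_exp_inner_pos hK (hvol.trans_ne one_ne_zero) _)).2 ?_
  rw [Real.exp_add, Real.exp_log (half_pos hδ)]
  calc Real.exp (s * floatingWidth K δ θ) * (δ / 2)
      = ∫ _ in halfSpaceCap K θ (floatingWidth K δ θ), Real.exp (s * floatingWidth K δ θ) := by
        rw [setIntegral_const, hcap, smul_eq_mul, mul_comm]
    _ ≤ ∫ y in halfSpaceCap K θ (floatingWidth K δ θ), Real.exp (inner ℝ y (s • θ)) := by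
        refine setIntegral_mono_on (integrableOn_const
          (measure_ne_top_of_subset halfSpaceCap_subset hK.measure_lt_top.ne))
          (hint.mono_set halfSpaceCap_subset) (measurableSet_halfSpaceCap hK.measurableSet)
          fun y hy => ?_
        rw [real_inner_smul_right]
        gcongr
        exact hy.2.le
    _ ≤ ∫ y in K, Real.exp (inner ℝ y (s • θ)) :=
        setIntegral_mono_set hint (ae_of_all _ fun y => Real.exp_nonneg _)
          halfSpaceCap_subset.eventuallyLE

theorem mem_legendreLevelSet_iff :
    x ∈ legendreLevelSet K r ↔ ∀ u, inner ℝ x u - logLaplace K u ≤ r := by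
  simp only [legendreLevelSet, logLaplaceLegendre, Set.mem_ofPred_eq, iSup_le_iff,
    EReal.coe_le_coe_iff]

theorem legendreLevelSet_subset (hK : IsCompact K) (hconv : Convex ℝ K) (hvol : volume K = 1)
    (r : ℝ) : legendreLevelSet K r ⊆ K := by
  intro x hx
  by_contra hxK
  obtain ⟨f, a, hfa, hax⟩ := geometric_hahn_banach_closed_point hconv hK.isClosed hxK
  let v := (InnerProductSpace.toDual ℝ _).symm f
  have hv : ∀ y, inner ℝ y v = f y := fun y => by
    rw [real_inner_comm, InnerProductSpace.toDual_symm_apply]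
  have hbound : ∀ s : ℝ, 0 ≤ s → s * (f x - a) ≤ r := by
    intro s hs
    have hlevel := mem_legendreLevelSet_iff.1 hx (s • v)
    have hLaplace : logLaplace K (s • v) ≤ s * a := by
      refine logLaplace_le_of_forall_inner_le hK hvol fun y hy => ?_
      rw [real_inner_smul_right, hv]
      exact mul_le_mul_of_nonneg_left (hfa y hy).le hs
    rw [real_inner_smul_right, hv] at hlevel
    linarith
  have hgap : 0 < f x - a := sub_pos.2 hax
  have hcontra := hbound ((|r| + 1) / (f x - a)) (by positivity)
  rw [div_mul_cancel₀ _ hgap.ne'] at hcontra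
  linarith [le_abs_self r]

theorem log_two_le_log_one_div (hδ : 0 < δ) (hδ₂ : δ ≤ 1 / 2) :
    Real.log 2 ≤ Real.log (1 / δ) :=
  Real.log_le_log two_pos ((le_one_div two_pos hδ).2 hδ₂)

theorem inner_le_five_mul_floatingWidth (hK : IsCompact K) (hconv : Convex ℝ K)
    (hsymm : ∀ x ∈ K, -x ∈ K) (hvol : volume K = 1) (hθ : θ ≠ 0) (hδ : 0 < δ) (hδ₂ : δ ≤ 1 / 2)
    (hx : x ∈ legendreLevelSet K (Real.log (1 / δ))) :
    inner ℝ x θ ≤ 5 * floatingWidth K δ θ := by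
  have hT := floatingWidth_pos hK hvol hθ hδ (by linarith)
  have hcap := volume_halfSpaceCap_floatingWidth_eq_mul hK hsymm hvol hθ hδ (by linarith)
  have hlog2 := Real.log_pos one_lt_two
  have hr := log_two_le_log_one_div hδ hδ₂
  have hexp : Real.exp (-Real.log (1 / δ)) = δ := by
    rw [one_div, Real.log_inv, neg_neg, Real.exp_log hδ]
  set T := floatingWidth K δ θ
  set r := Real.log (1 / δ)
  have hlevel := mem_legendreLevelSet_iff.1 hx ((r / (2 * T)) • θ)
  have hLaplace := logLaplace_smul_le_of_volume_halfSpaceCap_le hK hconv hvol hT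
    (hlog2.trans_le hr) (hexp.symm ▸ hcap.le)
  rw [real_inner_smul_right] at hlevel
  have hscaled : r / (2 * T) * inner ℝ x θ ≤ r / (2 * T) * (5 * T) :=
    calc r / (2 * T) * inner ℝ x θ ≤ 5 / 2 * r := by linarith
      _ = r / (2 * T) * (5 * T) := by field_simp
  have hr_pos : 0 < r := hlog2.trans_le hr
  exact le_of_mul_le_mul_left hscaled (by positivity)

theorem smul_legendreLevelSet_subset_floatingBody (hK : IsCompact K) (hconv : Convex ℝ K)
    (hsymm : ∀ x ∈ K, -x ∈ K) (hvol : volume K = 1) (hδ : 0 < δ) (hδ₂ : δ ≤ 1 / 2) :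
    (1 / 5 : ℝ) • legendreLevelSet K (Real.log (1 / δ)) ⊆ floatingBody K δ := by
  rintro _ ⟨x, hx, rfl⟩
  have hxK : x ∈ K := legendreLevelSet_subset hK hconv hvol _ hx
  have hzero : (0 : EuclideanSpace ℝ (Fin n)) ∈ K :=
    midpoint_self_neg ℝ x ▸ hconv.midpoint_mem hxK (hsymm x hxK)
  refine Set.mem_iInter₂.2 fun θ hθ =>
    ⟨hconv.smul_mem_of_zero_mem hzero hxK ⟨by norm_num, by norm_num⟩, ?_⟩
  have hθ₀ : θ ≠ 0 := ne_zero_of_mem_unit_sphere ⟨θ, hθ⟩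
  have hle := inner_le_five_mul_floatingWidth hK hconv hsymm hvol hθ₀ hδ hδ₂ hx
  have hle_neg := inner_le_five_mul_floatingWidth hK hconv hsymm hvol (neg_ne_zero.2 hθ₀) hδ hδ₂ hx
  rw [floatingWidth_neg, inner_neg_right] at hle_neg
  rw [real_inner_smul_left, abs_le]
  constructor <;> linarith

theorem floatingBody_subset_smul_legendreLevelSet (hK : IsCompact K) (hsymm : ∀ x ∈ K, -x ∈ K)
    (hvol : volume K = 1) (hδ : 0 < δ) (hδ₂ : δ ≤ 1 / 2) :
    floatingBody K δ ⊆ (2 : ℝ) • legendreLevelSet K (Real.log (1 / δ)) := by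
  intro x hx
  refine ⟨(2⁻¹ : ℝ) • x, mem_legendreLevelSet_iff.2 fun u => ?_, smul_inv_smul₀ two_ne_zero x⟩
  have hLaplace_nonneg := logLaplace_nonneg hK hsymm hvol u
  have hr := log_two_le_log_one_div hδ hδ₂
  have hlog2 := Real.log_pos one_lt_two
  rcases eq_or_ne u 0 with rfl | hu
  · rw [inner_zero_right]
    linarith
  set θ := NormedSpace.normalize u
  have hθ : ‖θ‖ = 1 := NormedSpace.norm_normalize hu
  have hu_eq : ‖u‖ • θ = u := NormedSpace.norm_smul_normalize u
  have hinner : inner ℝ ((2⁻¹ : ℝ) • x) u ≤ ‖u‖ * floatingWidth K δ θ / 2 := by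
    have hxθ : |inner ℝ x θ| ≤ floatingWidth K δ θ :=
      (Set.mem_iInter₂.1 hx θ (mem_sphere_zero_iff_norm.2 hθ)).2
    rw [← hu_eq, real_inner_smul_left, real_inner_smul_right, hu_eq, inv_mul_eq_div]
    gcongr
    exact (le_abs_self _).trans hxθ
  have hLaplace := mul_floatingWidth_add_log_le_logLaplace hK hsymm hvol
    (norm_ne_zero_iff.1 (hθ.trans_ne one_ne_zero)) hδ (by linarith) (norm_nonneg u)
  rw [hu_eq, Real.log_div hδ.ne' two_ne_zero] at hLaplace
  rw [one_div, Real.log_inv] at hr ⊢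
  -- `Λ_K(u) ≥ 0` settles the first case, the volume of the cap (`hLaplace`) the second.
  rcases le_total (‖u‖ * floatingWidth K δ θ) (2 * -Real.log δ) with _ | _ <;> linarith

end FloatingBody

theorem mainTheorem11 :
    ∃ c₁ c₂ : ℝ, 0 < c₁ ∧ 0 < c₂ ∧
      ∀ (n : ℕ) (K : ConvexBody (EuclideanSpace ℝ (Fin n))),
        (∀ x ∈ K, -x ∈ K) →
        volume (K : Set (EuclideanSpace ℝ (Fin n))) = 1 →
        ∀ δ : ℝ, 0 < δ → δ < 1 / 2 →
          c₁ • legendreLevelSet (K : Set (EuclideanSpace ℝ (Fin n))) (Real.log (1 / δ)) ⊆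
              floatingBody (K : Set (EuclideanSpace ℝ (Fin n))) δ ∧
            floatingBody (K : Set (EuclideanSpace ℝ (Fin n))) δ ⊆
              c₂ • legendreLevelSet (K : Set (EuclideanSpace ℝ (Fin n))) (Real.log (1 / δ)) := by
  refine ⟨1 / 5, 2, by norm_num, two_pos, fun n K hsymm hvol δ hδ hδ₂ => ⟨?_, ?_⟩⟩
  · exact smul_legendreLevelSet_subset_floatingBody K.isCompact K.convex hsymm hvol hδ hδ₂.le
  · exact floatingBody_subset_smul_legendreLevelSet K.isCompact hsymm hvol hδ hδ₂.le
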